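/- Let $N,M\ge 0$ be integers, let $K$ be a field, and let $\widetilde\alpha=(\alpha_0,\dots,\alpha_{N+M})$ and $\widetilde\gamma=(\gamma_0,\dots,\gamma_{N+M})$ be elements of $K$. For $0\le\mu\le N+M-1$ and $z\in K\setminus\{0\}$ put $$g_\mu(z|\widetilde\alpha|\widetilde\gamma)=\prod_{j=0}^{\mu}\bigl(\alpha_j+(1-\alpha_j\gamma_j)z\bigr)\prod_{j=\mu+2}^{N+M}(1-\gamma_j z)\prod_{j=1}^{N+M}(1-\gamma_j z^{-1}).$$ For $n\in\{N,M\}$, a partition $\lambda=(\lambda_1\ge\dots\ge\lambda_n\ge 0)$ with $\lambda_1\le N+M-n$, and variables $\mathbf z=(z_1,\dots,z_n)$ in $K\setminus\{0\}$ with $\det_{1\le j,k\le n}\bigl(z_k^{\,n-j+1}-z_k^{-n+j-1}\bigr)\neq 0$, the generalized factorial symplectic Schur function is $$sp_\lambda(\mathbf z|\widetilde\alpha|\widetilde\gamma)=\frac{\det_{1\le j,k\le n}\bigl(g_{\lambda_j+n-j}(z_k|\widetilde\alpha|\widetilde\gamma)-g_{\lambda_j+n-j}(z_k^{-1}|\widetilde\alpha|\widetilde\gamma)\bigr)}{\det_{1\le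 j,k\le n}\bigl(z_k^{\,n-j+1}-z_k^{-n+j-1}\bigr)}$$ (empty determinants are equal to $1$). Theorem (dual Cauchy formula). Let $\mathbf x=(x_1,\dots,x_N)$ and $\mathbf y=(y_1,\dots,y_M)$ be nonzero elements of $K$ for which the denominators $\det_{1\le j,k\le N}(x_k^{N-j+1}-x_k^{-N+j-1})$ and $\det_{1\le j,k\le M}(y_k^{M-j+1}-y_k^{-M+j-1})$ do not vanish. Then $$\sum_{\lambda\subseteq M^N}sp_\lambda(\mathbf x|\widetilde\alpha|\widetilde\gamma)\,sp_{\hat\lambda}(\mathbf y|{-\widetilde\alpha}|{-\widetilde\gamma})=\prod_{j=1}^{M}y_j^{-N}\prod_{j=1}^{N}\prod_{k=1}^{M}(1+x_jy_k)(1+x_j^{-1}y_k)\prod_{0\le j<k\le N+M}\bigl(1+\alpha_j(\gamma_k-\gamma_j)\bigr)\prod_{1\le j<k\le N+M}(1-\gamma_j\gamma_k),$$ where the sum runs over all partitions $\lambda=(\lambda_1,\dots,\lambda_N)$ with $M\ge\lambda_1\ge\dots\ge\lambda_N\ge0$, where $-\widetilde\alpha=(-\alpha_0,\dots,-\alpha_{N+M})$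 and $-\widetilde\gamma=(-\gamma_0,\dots,-\gamma_{N+M})$, and where $\hat\lambda=(\hat\lambda_1,\dots,\hat\lambda_M)$ is the partition $\hat\lambda_i=|\{j\mid\lambda_j\le M-i\}|$. -/

import Mathlib

namespace FactorialSymplectic

/-- The one-variable building block
`g_μ(z) = ∏_{j=0}^{μ} (α_j + (1 - α_j γ_j) z) ∏_{j=μ+2}^{L} (1 - γ_j z) ∏_{j=1}^{L} (1 - γ_j z⁻¹)`.
Here `L` is the number of lattice sites; only `α_0, …, α_μ` and `γ_0, …, γ_{max(μ, L)}` occur. -/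
def g {K : Type*} [Field K] (L : ℕ) (α γ : ℕ → K) (μ : ℕ) (z : K) : K :=
  (∏ j ∈ Finset.Icc 0 μ, (α j + (1 - α j * γ j) * z)) *
    (∏ j ∈ Finset.Icc (μ + 2) L, (1 - γ j * z)) *
    ∏ j ∈ Finset.Icc 1 L, (1 - γ j * z⁻¹)

/-- The determinant `G_μ(z) = det (g_{μ_j}(z_k) - g_{μ_j}(z_k⁻¹))`, with row index `j` and
column index `k`. -/
def G {K : Type*} [Field K] (L : ℕ) (α γ : ℕ → K) {n : ℕ} (μ : Fin n → ℕ) (z : Fin n → K) : K :=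
  (Matrix.of fun j k : Fin n => g L α γ (μ j) (z k) - g L α γ (μ j) (z k)⁻¹).det

/-- The Weyl denominator of type C, `det (z_k^{n-j+1} - z_k^{-n+j-1})` with `j`, `k` running over
`1, …, n`. The row index `j : Fin n` counts from zero, so `n - j` stands for `n - j + 1`. -/
def weylDenom {K : Type*} [Field K] {n : ℕ} (z : Fin n → K) : K :=
  (Matrix.of fun j k : Fin n =>
    z k ^ ((n : ℤ) - ((j : ℕ) : ℤ)) - z k ^ (-((n : ℤ) - ((j : ℕ) : ℤ)))).det

/-- The generalized factorial symplectic Schur function in `n` variables,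
`sp_lam(z | α | γ) = G_{lam + δ}(z | α | γ) / det (z_k^{n-j+1} - z_k^{-n+j-1})`,
with `δ = (n-1, n-2, …, 0)`, on a lattice with `L` sites. -/
def sp {K : Type*} [Field K] (L : ℕ) (α γ : ℕ → K) {n : ℕ} (lam : Fin n → ℕ) (z : Fin n → K) : K :=
  G L α γ (fun j => lam j + (n - 1 - (j : ℕ))) z / weylDenom z

/-- The partitions `lam = (lam_1 ≥ ⋯ ≥ lam_N ≥ 0)` contained in the rectangle `M^N`,
that is, with `lam_1 ≤ M`. -/
def boxPartitions (N M : ℕ) : Finset (Fin N → ℕ) :=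
  (Fintype.piFinset fun _ : Fin N => Finset.range (M + 1)).filter
    fun lam => ∀ i j : Fin N, i ≤ j → lam j ≤ lam i

/-- The partition `hat lam = (hat lam_1, …, hat lam_M)` with
`hat lam_i = |{j | lam_j ≤ M - i}|`. The index `i : Fin M` counts from zero. -/
def hat {N : ℕ} (M : ℕ) (lam : Fin N → ℕ) (i : Fin M) : ℕ :=
  (Finset.univ.filter fun j : Fin N => lam j ≤ M - ((i : ℕ) + 1)).card

end FactorialSymplectic

namespace FactorialSymplectic

/-! Put `L = N + M` and evaluate in two ways the `L × L` determinant `G` built from all of `g_0, …,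
g_{L-1}` in the variables `(x, -y)`.

Each antisymmetrized `g_μ` with `μ < L` is a combination of `z^i - z^{-i}`, `1 ≤ i ≤ L`, so the
determinant is a constant times `weylDenom`. At `(γ_L, …, γ_1)` the matrix is triangular
(`G_at_gamma`), which identifies the constant for generic `γ`; a polynomial identity in `γ` removes
genericity (`G_staircase_eq`). The denominator splits into those of `x` and `-y` and a product over
mixed pairs (`weylDenom_append`).

Laplace expansion along the columns of `x` instead gives a signed sum over complementary row sets,
that is, over pairs of `lam` and `hat lam` (`G_staircase_append`). Passing from `-y` to `y` negates
`α` and `γ`, and all signs cancel (`sum_G_mul_G_neg`). -/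

/-! ### Shuffles and Laplace expansion -/

/-- The permutations of `Fin (N + M)` that are increasing on each of the two blocks. -/
def shuffles (N M : ℕ) : Finset (Equiv.Perm (Fin (N + M))) :=
  open Classical in Finset.univ.filter fun σ =>
    (StrictMono fun a : Fin N => σ (Fin.castAdd M a)) ∧ StrictMono fun b : Fin M => σ (Fin.natAdd N b)

lemma mem_shuffles {N M : ℕ} {σ : Equiv.Perm (Fin (N + M))} :
    σ ∈ shuffles N M ↔ (StrictMono fun a : Fin N => σ (Fin.castAdd M a)) ∧
      StrictMono fun b : Fin M => σ (Fin.natAdd N b) := by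
  simp [shuffles]

/-- The permutation of `Fin (N + M)` acting on the two blocks separately. -/
def blockPerm {N M : ℕ} (τ : Equiv.Perm (Fin N)) (τ' : Equiv.Perm (Fin M)) :
    Equiv.Perm (Fin (N + M)) :=
  finSumFinEquiv.permCongr (Equiv.Perm.sumCongr τ τ')

@[simp] lemma blockPerm_castAdd {N M : ℕ} (τ : Equiv.Perm (Fin N)) (τ' : Equiv.Perm (Fin M))
    (a : Fin N) : blockPerm τ τ' (Fin.castAdd M a) = Fin.castAdd M (τ a) := by
  simp [blockPerm, Equiv.permCongr_apply]

@[simp] lemma blockPerm_natAdd {N M : ℕ} (τ : Equiv.Perm (Fin N)) (τ' : Equiv.Perm (Fin M))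
    (b : Fin M) : blockPerm τ τ' (Fin.natAdd N b) = Fin.natAdd N (τ' b) := by
  simp [blockPerm, Equiv.permCongr_apply]

lemma sign_blockPerm {N M : ℕ} (τ : Equiv.Perm (Fin N)) (τ' : Equiv.Perm (Fin M)) :
    (blockPerm τ τ').sign = τ.sign * τ'.sign := by
  simp [blockPerm, Equiv.Perm.sign_permCongr, Equiv.Perm.sign_sumCongr]

lemma perm_ext_blocks {N M : ℕ} {σ σ' : Equiv.Perm (Fin (N + M))}
    (h : ∀ a : Fin N, σ (Fin.castAdd M a) = σ' (Fin.castAdd M a))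
    (h' : ∀ b : Fin M, σ (Fin.natAdd N b) = σ' (Fin.natAdd N b)) : σ = σ' :=
  Equiv.ext fun k => Fin.addCases h h' k

lemma mem_range_natAdd_iff {N M : ℕ} (σ : Equiv.Perm (Fin (N + M))) (k : Fin (N + M)) :
    (k ∈ Set.range fun b : Fin M => σ (Fin.natAdd N b)) ↔
      k ∉ Set.range fun a : Fin N => σ (Fin.castAdd M a) := by
  obtain ⟨k, rfl⟩ := σ.surjective k
  refine Fin.addCases (fun a => ?_) (fun b => ?_) k
  · have : ∀ b : Fin M, Fin.natAdd N b ≠ Fin.castAdd M a := fun b h => by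
      have := congrArg Fin.val h; simp at this; omega
    simp [this]
  · have : ∀ a : Fin N, Fin.castAdd M a ≠ Fin.natAdd N b := fun a h => by
      have := congrArg Fin.val h; simp at this; omega
    simp [this]

/-- A shuffle is determined by the image of the first block. -/
lemma shuffle_ext {N M : ℕ} {σ σ' : Equiv.Perm (Fin (N + M))}
    (hσ : σ ∈ shuffles N M) (hσ' : σ' ∈ shuffles N M)
    (h : (Set.range fun a : Fin N => σ (Fin.castAdd M a)) =
      Set.range fun a : Fin N => σ' (Fin.castAdd M a)) : σ = σ' := by
  rw [mem_shuffles] at hσ hσ'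
  have h' : (Set.range fun b : Fin M => σ (Fin.natAdd N b)) =
      Set.range fun b : Fin M => σ' (Fin.natAdd N b) := by
    ext k; rw [mem_range_natAdd_iff, mem_range_natAdd_iff, h]
  exact perm_ext_blocks (congrFun ((hσ.1.range_inj hσ'.1).1 h))
    (congrFun ((hσ.2.range_inj hσ'.2).1 h'))

lemma exists_strictMono_comp_perm {n m : ℕ} {f : Fin n → Fin m} (hf : Function.Injective f) :
    ∃ τ : Equiv.Perm (Fin n), StrictMono fun i => f (τ i) :=
  ⟨Tuple.sort f, (Tuple.monotone_sort f).strictMono_of_injective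
    (hf.comp (Tuple.sort f).injective)⟩

/-- Laplace expansion of a determinant along the first `N` columns. -/
theorem det_eq_sum_shuffles {R : Type*} [CommRing R] {N M : ℕ}
    (A : Matrix (Fin (N + M)) (Fin (N + M)) R) :
    A.det = ∑ σ ∈ shuffles N M, ((σ.sign : ℤ) : R) *
      ((Matrix.of fun i j : Fin N => A (σ (Fin.castAdd M i)) (Fin.castAdd M j)).det *
        (Matrix.of fun i j : Fin M => A (σ (Fin.natAdd N i)) (Fin.natAdd N j)).det) := by
  simp only [Matrix.det_apply', Finset.sum_mul_sum]
  simp only [← Finset.sum_product', Finset.mul_sum]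
  symm
  -- Every permutation factors uniquely as a shuffle times a block permutation; the shuffle is
  -- obtained by sorting the values on each block.
  refine Finset.sum_bij (fun p _ => p.1 * blockPerm p.2.1 p.2.2) (fun _ _ => Finset.mem_univ _)
    ?_ ?_ ?_
  · rintro ⟨σ, τ, τ'⟩ hp ⟨ρ, π, π'⟩ hq h
    simp only [Finset.mem_product, Finset.mem_univ, and_true] at hp hq h
    have h1 : ∀ a, σ (Fin.castAdd M (τ a)) = ρ (Fin.castAdd M (π a)) := fun a => by
      simpa using Equiv.congr_fun h (Fin.castAdd M a)
    have h2 : ∀ a, σ (Fin.natAdd N (τ' a)) = ρ (Fin.natAdd N (π' a)) := fun a => by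
      simpa using Equiv.congr_fun h (Fin.natAdd N a)
    have hσρ : σ = ρ := by
      refine shuffle_ext hp hq ?_
      rw [← τ.surjective.range_comp, ← π.surjective.range_comp (fun a => ρ (Fin.castAdd M a))]
      exact congrArg Set.range (funext h1)
    subst hσρ
    have e1 : τ = π := Equiv.ext fun a => by simpa using h1 a
    have e2 : τ' = π' := Equiv.ext fun a => by simpa using h2 a
    rw [e1, e2]
  · intro σ _
    obtain ⟨τ, hτ⟩ := exists_strictMono_comp_perm (f := fun a : Fin N => σ (Fin.castAdd M a))
      (fun a b h => by simpa using h)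
    obtain ⟨τ', hτ'⟩ := exists_strictMono_comp_perm (f := fun a : Fin M => σ (Fin.natAdd N a))
      (fun a b h => by simpa using h)
    refine ⟨⟨σ * blockPerm τ τ', τ⁻¹, τ'⁻¹⟩, ?_, ?_⟩
    · simpa [mem_shuffles] using ⟨hτ, hτ'⟩
    · exact perm_ext_blocks (by simp) (by simp)
  · rintro ⟨σ, τ, τ'⟩ _
    simp only [Matrix.of_apply, Equiv.Perm.mul_apply, Fin.prod_univ_add, blockPerm_castAdd,
      blockPerm_natAdd, Equiv.Perm.sign_mul, sign_blockPerm]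
    push_cast
    ring

/-! ### Shuffles and partitions in a box -/

/-- The values below `k` taken on the two blocks add up to `k` many. -/
lemma card_lt_add_card_lt {N M : ℕ} (σ : Equiv.Perm (Fin (N + M))) (k : Fin (N + M)) :
    (Finset.univ.filter fun a : Fin N => σ (Fin.castAdd M a) < k).card +
      (Finset.univ.filter fun b : Fin M => σ (Fin.natAdd N b) < k).card = k := by
  have h : (Finset.univ.filter fun i : Fin (N + M) => σ i < k).card = k := by
    rw [← Fin.card_Iio k]
    refine Finset.card_bij (fun i _ => σ i) (by simp) (by simp) fun b hb => ⟨σ.symm b, ?_, by simp⟩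
    simpa using hb
  conv_rhs => rw [← h]
  simp_rw [Finset.card_filter, Fin.sum_univ_add]

lemma card_filter_lt_self {n : ℕ} {β : Type*} [LinearOrder β] {f : Fin n → β} (hf : StrictMono f)
    (a : Fin n) : (Finset.univ.filter fun i => f i < f a).card = a := by
  simp_rw [hf.lt_iff_lt]
  rw [← Fin.card_Iio a]
  congr 1; ext; simp

/-- The number of values of a strictly increasing sequence below `k` exceeds `b` if and only if its
entry at `b` is below `k`. -/
lemma lt_card_filter_lt_iff {n : ℕ} {β : Type*} [LinearOrder β] {f : Fin n → β}
    (hf : StrictMono f) (b : Fin n) (k : β) :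
    (b : ℕ) < (Finset.univ.filter fun i => f i < k).card ↔ f b < k := by
  constructor
  · intro h
    by_contra hk
    have : (Finset.univ.filter fun i => f i < k) ⊆ Finset.univ.filter fun i => f i < f b := by
      intro i; simp only [Finset.mem_filter, Finset.mem_univ, true_and]
      exact fun h => h.trans_le (not_lt.1 hk)
    have := Finset.card_le_card this
    rw [card_filter_lt_self hf] at this
    omega
  · intro h
    have : Finset.Iic b ⊆ (Finset.univ.filter fun i => f i < k) := by
      intro i; simp only [Finset.mem_filter, Finset.mem_univ, true_and, Finset.mem_Iic]
      exact fun hi => (hf.monotone hi).trans_lt h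
    have := Finset.card_le_card this
    rw [Fin.card_Iic] at this
    omega

/-- The partition attached to a shuffle. -/
def shufflePartition {N M : ℕ} (σ : Equiv.Perm (Fin (N + M))) (a : Fin N) : ℕ :=
  M - (Finset.univ.filter fun b : Fin M => σ (Fin.natAdd N b) < σ (Fin.castAdd M a)).card

/-- Below the value at `a` lie `a` first-block values and, by definition of the partition, `M -
lam_a` second-block values. Reversing row indices thus gives the exponents `lam + δ`. -/
lemma shuffle_castAdd {N M : ℕ} {σ : Equiv.Perm (Fin (N + M))} (hσ : σ ∈ shuffles N M)
    (a : Fin N) : (σ (Fin.castAdd M a) : ℕ) + shufflePartition σ a = M + a := by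
  have h1 := card_lt_add_card_lt σ (σ (Fin.castAdd M a))
  rw [card_filter_lt_self (mem_shuffles.1 hσ).1] at h1
  have h2 := Finset.card_filter_le (Finset.univ : Finset (Fin M))
    fun b => σ (Fin.natAdd N b) < σ (Fin.castAdd M a)
  rw [Finset.card_univ, Fintype.card_fin] at h2
  unfold shufflePartition
  omega

/-- `lam_a ≤ M - (b + 1)` says that more than `b` second-block values lie below the value at `a`;
these values increase, so this means that the one at `b` does. -/
lemma hat_shufflePartition {N M : ℕ} {σ : Equiv.Perm (Fin (N + M))} (hσ : σ ∈ shuffles N M)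
    (b : Fin M) : hat M (shufflePartition σ) b =
      (Finset.univ.filter fun a : Fin N => σ (Fin.natAdd N b) < σ (Fin.castAdd M a)).card := by
  unfold hat
  congr 1
  ext a
  simp only [Finset.mem_filter, Finset.mem_univ, true_and]
  rw [← lt_card_filter_lt_iff (mem_shuffles.1 hσ).2 b]
  have h2 := Finset.card_filter_le (Finset.univ : Finset (Fin M))
    fun b => σ (Fin.natAdd N b) < σ (Fin.castAdd M a)
  rw [Finset.card_univ, Fintype.card_fin] at h2
  unfold shufflePartition
  omega

lemma shuffle_natAdd {N M : ℕ} {σ : Equiv.Perm (Fin (N + M))} (hσ : σ ∈ shuffles N M)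
    (b : Fin M) : (σ (Fin.natAdd N b) : ℕ) + hat M (shufflePartition σ) b = N + b := by
  have h1 := card_lt_add_card_lt σ (σ (Fin.natAdd N b))
  rw [card_filter_lt_self (mem_shuffles.1 hσ).2] at h1
  have h2 := Finset.card_filter_add_card_filter_not (s := (Finset.univ : Finset (Fin N)))
    fun a => σ (Fin.castAdd M a) < σ (Fin.natAdd N b)
  rw [Finset.card_univ, Fintype.card_fin] at h2
  have h3 : (Finset.univ.filter fun a : Fin N => ¬ σ (Fin.castAdd M a) < σ (Fin.natAdd N b)) =
      Finset.univ.filter fun a : Fin N => σ (Fin.natAdd N b) < σ (Fin.castAdd M a) := by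
    ext a
    have : σ (Fin.natAdd N b) ≠ σ (Fin.castAdd M a) := fun h => by
      have := congrArg Fin.val (σ.injective h); simp at this; omega
    simp [this.le_iff_lt]
  rw [h3] at h2
  rw [hat_shufflePartition hσ]
  omega

lemma mem_boxPartitions {N M : ℕ} {lam : Fin N → ℕ} :
    lam ∈ boxPartitions N M ↔ (∀ i, lam i ≤ M) ∧ Antitone lam := by
  simp [boxPartitions, Antitone]

lemma shufflePartition_mem {N M : ℕ} {σ : Equiv.Perm (Fin (N + M))} (hσ : σ ∈ shuffles N M) :
    shufflePartition σ ∈ boxPartitions N M := by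
  refine mem_boxPartitions.2 ⟨fun i => Nat.sub_le _ _, fun i j hij => ?_⟩
  refine Nat.sub_le_sub_left (Finset.card_le_card fun b => ?_) _
  simp only [Finset.mem_filter, Finset.mem_univ, true_and]
  exact fun h => h.trans_le ((mem_shuffles.1 hσ).1.monotone hij)

lemma shufflePartition_injOn (N M : ℕ) :
    Set.InjOn (shufflePartition (N := N) (M := M)) (shuffles N M) := by
  intro σ hσ σ' hσ' h
  refine shuffle_ext hσ hσ' (congrArg Set.range (funext fun a => Fin.ext ?_))
  have h1 := shuffle_castAdd hσ a
  have h2 := shuffle_castAdd hσ' a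
  rw [h] at h1
  omega

lemma exists_shufflePartition_eq {N M : ℕ} {lam : Fin N → ℕ} (h : lam ∈ boxPartitions N M) :
    ∃ σ ∈ shuffles N M, shufflePartition σ = lam := by
  obtain ⟨hM, hlam⟩ := mem_boxPartitions.1 h
  -- These positions are forced by `shuffle_castAdd`; the shuffle lists them, then their complement.
  let m : Fin N → Fin (N + M) := fun a => ⟨M - lam a + a, by omega⟩
  have hm : StrictMono m := fun a b hab => by
    have := hlam hab.le
    have := hM a
    simp only [m, Fin.mk_lt_mk]
    have : (a : ℕ) < b := hab
    omega
  let s : Finset (Fin (N + M)) := Finset.univ.map ⟨m, hm.injective⟩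
  have hs : s.card = N := by simp [s]
  have hs' : sᶜ.card = M := by rw [Finset.card_compl, hs]; simp
  let σ : Equiv.Perm (Fin (N + M)) := finSumFinEquiv.symm.trans (finSumEquivOfFinset hs hs')
  have h1 : ∀ a, σ (Fin.castAdd M a) = s.orderEmbOfFin hs a := fun a => by
    simp [σ, finSumEquivOfFinset_inl]
  have h2 : ∀ a, σ (Fin.natAdd N a) = sᶜ.orderEmbOfFin hs' a := fun a => by
    simp [σ, finSumEquivOfFinset_inr]
  have h3 : m = s.orderEmbOfFin hs := Finset.orderEmbOfFin_unique hs (fun a => by simp [s]) hm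
  have hσ : σ ∈ shuffles N M := by
    rw [mem_shuffles]
    simp only [h1, h2]
    exact ⟨(s.orderEmbOfFin hs).strictMono, (sᶜ.orderEmbOfFin hs').strictMono⟩
  refine ⟨σ, hσ, funext fun a => ?_⟩
  have h4 := shuffle_castAdd hσ a
  rw [h1, ← h3] at h4
  have := hM a
  simp only [m] at h4
  omega

lemma sum_shuffles_eq_sum_boxPartitions {R : Type*} [AddCommMonoid R] (N M : ℕ)
    (f : (Fin N → ℕ) → R) :
    ∑ σ ∈ shuffles N M, f (shufflePartition σ) = ∑ lam ∈ boxPartitions N M, f lam :=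
  Finset.sum_bij (fun σ _ => shufflePartition σ) (fun _ h => shufflePartition_mem h)
    (fun _ h _ h' e => shufflePartition_injOn N M h h' e)
    (fun _ h => by simpa using exists_shufflePartition_eq h) (fun _ _ => rfl)

lemma prod_Ioi_eq_prod_ite {R : Type*} [CommMonoid R] {n : ℕ} (i : Fin n) (f : Fin n → R) :
    ∏ j ∈ Finset.Ioi i, f j = ∏ j, if i < j then f j else 1 := by
  rw [← Finset.prod_filter]
  congr 1; ext; simp

/-- Splitting a product over the pairs `i < j` in `Fin (N + M)`. -/
lemma prod_pairs_add {R : Type*} [CommMonoid R] {N M : ℕ} (f : Fin (N + M) → Fin (N + M) → R) :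
    ∏ i, ∏ j ∈ Finset.Ioi i, f i j =
      (∏ i : Fin N, ∏ j ∈ Finset.Ioi i, f (Fin.castAdd M i) (Fin.castAdd M j)) *
      (∏ i : Fin M, ∏ j ∈ Finset.Ioi i, f (Fin.natAdd N i) (Fin.natAdd N j)) *
      ∏ i : Fin N, ∏ j : Fin M, f (Fin.castAdd M i) (Fin.natAdd N j) := by
  have h1 : ∀ (i : Fin N) (j : Fin M), Fin.castAdd M i < Fin.natAdd N j := fun i j => by
    rw [Fin.lt_def]; simp; omega
  have h2 : ∀ (i : Fin N) (j : Fin M), ¬ Fin.natAdd N j < Fin.castAdd M i := fun i j =>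
    (h1 i j).le.not_gt
  simp_rw [prod_Ioi_eq_prod_ite, Fin.prod_univ_add]
  simp only [h1, h2, if_true, if_false, Finset.prod_const_one, one_mul, Finset.prod_mul_distrib,
    Fin.lt_def, Fin.val_castAdd, Fin.val_natAdd, add_lt_add_iff_left]
  exact mul_right_comm _ _ _

/-- Inversions occur only between the blocks, and `hat lam_b` counts those involving `b`. -/
lemma sign_shuffle {N M : ℕ} {σ : Equiv.Perm (Fin (N + M))} (hσ : σ ∈ shuffles N M) :
    σ.sign = ∏ b : Fin M, (-1) ^ hat M (shufflePartition σ) b := by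
  rw [Equiv.Perm.sign_eq_prod_prod_Ioi, prod_pairs_add]
  obtain ⟨h1, h2⟩ := mem_shuffles.1 hσ
  rw [Finset.prod_eq_one (s := Finset.univ) (f := fun i : Fin N => _), one_mul,
    Finset.prod_eq_one (s := Finset.univ) (f := fun i : Fin M => _), one_mul, Finset.prod_comm]
  · refine Finset.prod_congr rfl fun b _ => ?_
    rw [hat_shufflePartition hσ, Finset.card_filter, ← Finset.prod_pow_eq_pow_sum]
    refine Finset.prod_congr rfl fun a _ => ?_
    have : σ (Fin.natAdd N b) ≠ σ (Fin.castAdd M a) := fun h => by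
      have := congrArg Fin.val (σ.injective h); simp at this; omega
    rcases this.lt_or_gt with h | h
    · simp [h, h.le.not_gt]
    · simp [h, h.le.not_gt]
  · exact fun i _ => Finset.prod_eq_one fun j hj => if_pos (h2 (Finset.mem_Ioi.1 hj))
  · exact fun i _ => Finset.prod_eq_one fun j hj => if_pos (h1 (Finset.mem_Ioi.1 hj))

/-! ### The Weyl denominator of type C -/

open Polynomial

lemma zpow_sub_zpow_neg_eq {K : Type*} [Field K] {z : K} (hz : z ≠ 0) (n : ℕ) :
    z ^ (n + 1) - z⁻¹ ^ (n + 1) =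
      (z - z⁻¹) * (Chebyshev.S K n).eval (z + z⁻¹) := by
  induction n using Nat.twoStepInduction with
  | zero => simp
  | one =>
    simp
    ring
  | more n h1 h2 =>
    have : ((n + 2 : ℕ) : ℤ) = (n : ℤ) + 2 := by push_cast; rfl
    rw [this, Chebyshev.S_add_two, eval_sub, eval_mul, eval_X, mul_sub, ← h1, mul_left_comm]
    have e : (n : ℤ) + 1 = ((n + 1 : ℕ) : ℤ) := by push_cast; rfl
    rw [e, ← h2]
    have h : z * z⁻¹ = 1 := mul_inv_cancel₀ hz
    linear_combination (z⁻¹ ^ (n + 1) - z ^ (n + 1)) * h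

lemma monic_and_natDegree_S (R : Type*) [CommRing R] [Nontrivial R] (n : ℕ) :
    (Chebyshev.S R n).Monic ∧ (Chebyshev.S R n).natDegree = n := by
  induction n using Nat.twoStepInduction with
  | zero => simp
  | one => simp [monic_X]
  | more n h1 h2 =>
    have : ((n + 2 : ℕ) : ℤ) = (n : ℤ) + 2 := by push_cast; rfl
    have e : (n : ℤ) + 1 = ((n + 1 : ℕ) : ℤ) := by push_cast; rfl
    rw [this, Chebyshev.S_add_two, e]
    have hm : (X * Chebyshev.S R ((n + 1 : ℕ) : ℤ)).Monic := monic_X.mul h2.1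
    have hd : (X * Chebyshev.S R ((n + 1 : ℕ) : ℤ)).natDegree = n + 2 := by
      rw [monic_X.natDegree_mul h2.1, natDegree_X, h2.2]; omega
    have hlt : (Chebyshev.S R (n : ℤ)).degree < (X * Chebyshev.S R ((n + 1 : ℕ) : ℤ)).degree := by
      rw [degree_eq_natDegree hm.ne_zero, degree_eq_natDegree h1.1.ne_zero, hd, h1.2]
      exact_mod_cast (by omega : n < n + 2)
    refine ⟨hm.sub_of_left hlt, ?_⟩
    rw [natDegree_sub_eq_left_of_natDegree_lt, hd]
    rw [hd, h1.2]; omega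

/-- The Weyl denominator formula of type C. -/
theorem weylDenom_eq_prod {K : Type*} [Field K] {n : ℕ} {z : Fin n → K} (hz : ∀ k, z k ≠ 0) :
    weylDenom z = (∏ k, (z k - (z k)⁻¹)) *
      ∏ i, ∏ j ∈ Finset.Ioi i, ((z i + (z i)⁻¹) - (z j + (z j)⁻¹)) := by
  set u : Fin n → K := fun k => z k + (z k)⁻¹ with hu
  have h1 : weylDenom z = (∏ k, (z k - (z k)⁻¹)) *
      (Matrix.of fun i j : Fin n => (Chebyshev.S K ((Fin.rev j : Fin n) : ℕ)).eval (u i)).det := by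
    rw [← Matrix.det_transpose (Matrix.of fun i j : Fin n => _), ← Matrix.det_mul_row, weylDenom]
    congr 1
    ext j k
    have e : (n : ℤ) - ((j : ℕ) : ℤ) = (((Fin.rev j : Fin n) : ℕ) + 1 : ℕ) := by
      rw [Fin.val_rev]; omega
    rw [Matrix.of_apply, Matrix.of_apply, Matrix.transpose_apply, Matrix.of_apply,
      ← zpow_sub_zpow_neg_eq (hz k), e, zpow_neg, zpow_natCast, inv_pow]
  -- Monic polynomials of degrees `0, …, n-1` give the Vandermonde determinant; reversing the
  -- columns on both sides costs the same sign and produces the factors `u i - u j` for `i < j`.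
  have h2 : (Matrix.of fun i j : Fin n =>
      (Chebyshev.S K ((Fin.rev j : Fin n) : ℕ)).eval (u i)).det =
      (Matrix.projVandermonde 1 u).det := by
    have h3 := Matrix.det_eval_matrixOfPolynomials_eq_det_vandermonde u
      (fun j => Chebyshev.S K ((j : ℕ) : ℤ)) (fun i => (monic_and_natDegree_S K i).2)
      (fun i => (monic_and_natDegree_S K i).1)
    have h4 := Matrix.det_permute' Fin.revPerm (Matrix.vandermonde u)
    have h5 := Matrix.det_permute' Fin.revPerm
      (Matrix.of fun i j : Fin n => (Chebyshev.S K ((j : ℕ) : ℤ)).eval (u i))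
    rw [h3, ← h5] at h4
    have h6 : Matrix.projVandermonde 1 u = (Matrix.vandermonde u).submatrix id Fin.revPerm := by
      ext i j
      simp [Matrix.projVandermonde_apply]
    rw [h6, h4]
    rfl
  rw [h1, h2, Matrix.det_projVandermonde]
  simp [hu]

lemma add_inv_sub_add_inv {K : Type*} [Field K] {a b : K} (ha : a ≠ 0) (hb : b ≠ 0) :
    (a + a⁻¹) - (b + b⁻¹) = a⁻¹ * (1 - a * b⁻¹) * (1 - b * a) := by
  field_simp
  ring

/-! ### The staircase determinant is a multiple of the denominator -/

/-- Because only the index `μ + 1` is skipped, the first two products together have `L` linear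
factors in `z`; the third has `L` factors in `z⁻¹`. -/
lemma exists_polynomial_g {K : Type*} [Field K] {L μ : ℕ} (hμ : μ < L) (α γ : ℕ → K) :
    ∃ P : K[X], P.natDegree < 2 * L + 1 ∧ ∀ z ≠ 0, g L α γ μ z = z⁻¹ ^ L * P.eval z := by
  refine ⟨(∏ j ∈ Finset.Icc 0 μ, (C (α j) + C (1 - α j * γ j) * X)) *
    (∏ j ∈ Finset.Icc (μ + 2) L, (1 - C (γ j) * X)) *
    ∏ j ∈ Finset.Icc 1 L, (X - C (γ j)), ?_, fun z hz => ?_⟩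
  · refine Nat.lt_succ_of_le ?_
    have h1 : (∏ j ∈ Finset.Icc 0 μ, (C (α j) + C (1 - α j * γ j) * X)).natDegree ≤ μ + 1 := by
      refine (natDegree_prod_le _ _).trans ((Finset.sum_le_card_nsmul _ _ 1 fun j _ => ?_).trans ?_)
      · compute_degree
      · simp
    have h2 : (∏ j ∈ Finset.Icc (μ + 2) L, (1 - C (γ j) * X)).natDegree ≤ L - (μ + 1) := by
      refine (natDegree_prod_le _ _).trans ((Finset.sum_le_card_nsmul _ _ 1 fun j _ => ?_).trans ?_)
      · compute_degree
      · simp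
    have h3 : (∏ j ∈ Finset.Icc 1 L, (X - C (γ j))).natDegree ≤ L := by
      refine (natDegree_prod_le _ _).trans ((Finset.sum_le_card_nsmul _ _ 1 fun j _ => ?_).trans ?_)
      · compute_degree
      · simp
    exact (natDegree_mul_le_of_le (natDegree_mul_le_of_le h1 h2) h3).trans (by omega)
  · have h : ∏ j ∈ Finset.Icc 1 L, (1 - γ j * z⁻¹) =
        z⁻¹ ^ L * ∏ j ∈ Finset.Icc 1 L, (z - γ j) := by
      have : z⁻¹ ^ L = ∏ j ∈ Finset.Icc 1 L, z⁻¹ := by simp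
      rw [this, ← Finset.prod_mul_distrib]
      refine Finset.prod_congr rfl fun j _ => ?_
      field_simp
    simp only [g, h, eval_mul, eval_prod, eval_add, eval_sub, eval_C, eval_X, eval_one]
    ring

/-- The antisymmetrization of `g_μ` is a combination of the rows of the Weyl denominator. -/
lemma exists_coeff_g_sub {K : Type*} [Field K] {L μ : ℕ} (hμ : μ < L) (α γ : ℕ → K) :
    ∃ c : Fin L → K, ∀ z ≠ 0, g L α γ μ z - g L α γ μ z⁻¹ =
      ∑ i : Fin L, c i * (z ^ ((L : ℤ) - ((i : ℕ) : ℤ)) - z ^ (-((L : ℤ) - ((i : ℕ) : ℤ)))) := by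
  obtain ⟨P, hP, hg⟩ := exists_polynomial_g hμ α γ
  -- The coefficients of `z^(L-i)` and `z^(i-L)` in `g`; the first index is `2L - i`, written to
  -- match the reflected upper half of the sum.
  refine ⟨fun i => P.coeff (L + 1 + (L - 1 - i)) - P.coeff i, fun z hz => ?_⟩
  have hzz : z * z⁻¹ = 1 := mul_inv_cancel₀ hz
  have key : ∀ a b : ℕ, z⁻¹ ^ a * z ^ (a + b) = z ^ b := fun a b => by
    rw [pow_add, ← mul_assoc, ← mul_pow, mul_comm z⁻¹, hzz, one_pow, one_mul]
  have key' : ∀ a b : ℕ, z ^ a * z⁻¹ ^ (a + b) = z⁻¹ ^ b := fun a b => by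
    rw [pow_add, ← mul_assoc, ← mul_pow, hzz, one_pow, one_mul]
  rw [hg z hz, hg _ (inv_ne_zero hz), inv_inv, eval_eq_sum_range' hP, eval_eq_sum_range' hP,
    Finset.mul_sum, Finset.mul_sum, ← Finset.sum_sub_distrib]
  rw [show 2 * L + 1 = L + 1 + L by ring, Finset.sum_range_add, Finset.sum_range_succ,
    Fin.sum_univ_eq_sum_range (fun i : ℕ => (P.coeff (L + 1 + (L - 1 - i)) - P.coeff i) *
      (z ^ ((L : ℤ) - (i : ℤ)) - z ^ (-((L : ℤ) - (i : ℤ))))),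
    ← Finset.sum_range_reflect (fun x => z⁻¹ ^ L * (P.coeff (L + 1 + x) * z ^ (L + 1 + x)) - _)]
  have hmid : z⁻¹ ^ L * (P.coeff L * z ^ L) - z ^ L * (P.coeff L * z⁻¹ ^ L) = 0 := by ring
  rw [hmid, add_zero, ← Finset.sum_add_distrib]
  refine Finset.sum_congr rfl fun i hi => ?_
  have hi := Finset.mem_range.1 hi
  obtain ⟨b, rfl⟩ : ∃ b, L = i + (b + 1) := ⟨L - i - 1, by omega⟩
  have e1 : ((i + (b + 1) : ℕ) : ℤ) - (i : ℤ) = ((b + 1 : ℕ) : ℤ) := by push_cast; ring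
  have e2 : i + (b + 1) - 1 - i = b := by omega
  rw [e1, e2, zpow_neg, zpow_natCast, ← inv_pow]
  have k1 := key (i + (b + 1)) (b + 1)
  have k2 := key' (i + (b + 1)) (b + 1)
  have k3 : z⁻¹ ^ (i + (b + 1)) * z ^ i = z⁻¹ ^ (b + 1) := by
    rw [pow_add, mul_right_comm, ← mul_pow, mul_comm z⁻¹, hzz, one_pow, one_mul]
  have k4 : z ^ (i + (b + 1)) * z⁻¹ ^ i = z ^ (b + 1) := by
    rw [pow_add, mul_right_comm, ← mul_pow, hzz, one_pow, one_mul]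
  rw [show i + (b + 1) + 1 + b = i + (b + 1) + (b + 1) by ring]
  linear_combination P.coeff (i + (b + 1) + (b + 1)) * (k1 - k2) + P.coeff i * (k3 - k4)

/-- The matrix is a coefficient matrix times the Weyl matrix, so `d` is the determinant of the
former and does not depend on `w`. -/
lemma exists_G_eq_mul_weylDenom {K : Type*} [Field K] (L : ℕ) (α γ : ℕ → K) :
    ∃ d : K, ∀ w : Fin L → K, (∀ k, w k ≠ 0) →
      G L α γ (fun j : Fin L => L - 1 - j) w = d * weylDenom w := by
  have h : ∀ j : Fin L, L - 1 - (j : ℕ) < L := fun j => by omega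
  choose c hc using fun j => exists_coeff_g_sub (h j) α γ
  refine ⟨(Matrix.of c).det, fun w hw => ?_⟩
  rw [G, weylDenom, ← Matrix.det_mul]
  congr 1
  ext j k
  simp only [Matrix.of_apply, Matrix.mul_apply]
  exact hc j (w k) (hw k)

/-! ### Finding the constant by specializing to `γ` -/

lemma prod_range_Ico_comm {R : Type*} [CommMonoid R] (L : ℕ) (h : ℕ → ℕ → R) :
    ∏ m ∈ Finset.range L, ∏ k ∈ Finset.Ico (m + 1) L, h m k =
      ∏ k ∈ Finset.range L, ∏ m ∈ Finset.range k, h m k :=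
  Finset.prod_comm' fun m k => by
    simp only [Finset.mem_range, Finset.mem_Ico]; omega

lemma prod_fin_pairs_rev {R : Type*} [CommMonoid R] (n : ℕ) (f : ℕ → ℕ → R) :
    ∏ i : Fin n, ∏ j ∈ Finset.Ioi i, f (n - 1 - i) (n - 1 - j) =
      ∏ m ∈ Finset.range n, ∏ l ∈ Finset.range m, f m l := by
  rw [← Equiv.prod_comp Fin.revPerm, ← Fin.prod_univ_eq_prod_range (fun m => ∏ l ∈ Finset.range m, f m l)]
  refine Finset.prod_congr rfl fun i _ => ?_
  refine Finset.prod_bij (fun j _ => n - 1 - (j : ℕ)) ?_ ?_ ?_ ?_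
  · intro j hj
    simp only [Finset.mem_Ioi, Fin.revPerm_apply, Fin.lt_def, Fin.val_rev] at hj
    simp only [Finset.mem_range]
    omega
  · intro j hj j' hj' h
    ext
    omega
  · intro l hl
    simp only [Finset.mem_range] at hl
    refine ⟨⟨n - 1 - l, by omega⟩, ?_, ?_⟩
    · simp only [Finset.mem_Ioi, Fin.revPerm_apply, Fin.lt_def, Fin.val_rev]; omega
    · simp only; omega
  · intro j hj
    congr 1
    simp only [Fin.revPerm_apply, Fin.val_rev]
    omega

/-- The constant in the dual Cauchy formula. -/
def cauchyConst {R : Type*} [CommRing R] (L : ℕ) (α γ : ℕ → R) : R :=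
  (∏ k ∈ Finset.range (L + 1), ∏ j ∈ Finset.range k, (1 + α j * (γ k - γ j))) *
    ∏ k ∈ Finset.Icc 1 L, ∏ j ∈ Finset.Ico 1 k, (1 - γ j * γ k)

lemma cauchyConst_eq_prod_range {R : Type*} [CommRing R] (L : ℕ) (α γ : ℕ → R) :
    cauchyConst L α γ = ∏ m ∈ Finset.range L,
      ((∏ j ∈ Finset.range (m + 1), (1 + α j * (γ (m + 1) - γ j))) *
        ∏ l ∈ Finset.range m, (1 - γ (l + 1) * γ (m + 1))) := by
  rw [cauchyConst, Finset.prod_range_succ', Finset.prod_mul_distrib, Finset.range_zero,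
    Finset.prod_empty, mul_one]
  congr 1
  rw [← Finset.Ico_add_one_right_eq_Icc, Finset.prod_Ico_eq_prod_range]
  refine Finset.prod_congr rfl fun m _ => ?_
  rw [Finset.prod_Ico_eq_prod_range, show 1 + m - 1 = m by omega, add_comm 1 m]
  exact Finset.prod_congr rfl fun l _ => by rw [add_comm 1 l]

lemma prod_Icc_add_one {R : Type*} [CommMonoid R] (m L : ℕ) (f : ℕ → R) :
    ∏ j ∈ Finset.Icc (m + 1) L, f j = ∏ k ∈ Finset.Ico m L, f (k + 1) := by
  rw [← Finset.Ico_add_one_right_eq_Icc, Finset.prod_Ico_add']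

/-- The antisymmetrization of `g_m` at `γ_{m+1}`. -/
lemma g_sub_at_gamma {K : Type*} [Field K] {L m : ℕ} (hm : m < L) (α γ : ℕ → K)
    (h0 : γ (m + 1) ≠ 0) :
    g L α γ m (γ (m + 1)) - g L α γ m (γ (m + 1))⁻¹ =
      (γ (m + 1) - (γ (m + 1))⁻¹) * (γ (m + 1))⁻¹ ^ m *
        (∏ j ∈ Finset.range (m + 1), (1 + α j * (γ (m + 1) - γ j))) *
        (∏ l ∈ Finset.range m, (1 - γ (l + 1) * γ (m + 1))) *
        ∏ k ∈ Finset.Ico (m + 1) L,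
          ((1 - γ (k + 1) * (γ (m + 1))⁻¹) * (1 - γ (k + 1) * γ (m + 1))) := by
  set a := γ (m + 1) with ha
  -- The third product contains `1 - a * a⁻¹`, so only the value at `a⁻¹` survives.
  have hz : g L α γ m a = 0 := by
    rw [g, Finset.prod_eq_zero (s := Finset.Icc 1 L) (i := m + 1) (by simp; omega), mul_zero]
    rw [← ha, mul_inv_cancel₀ h0, sub_self]
  have h1 : ∏ j ∈ Finset.Icc 0 m, (α j + (1 - α j * γ j) * a⁻¹) =
      a⁻¹ ^ (m + 1) * ∏ j ∈ Finset.range (m + 1), (1 + α j * (a - γ j)) := by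
    have : a⁻¹ ^ (m + 1) = ∏ j ∈ Finset.range (m + 1), a⁻¹ := by simp
    rw [this, ← Finset.prod_mul_distrib, Nat.range_succ_eq_Icc_zero]
    refine Finset.prod_congr rfl fun j _ => ?_
    field_simp
    ring
  have h2 : ∏ j ∈ Finset.Icc 1 L, (1 - γ j * a) = (∏ l ∈ Finset.range m, (1 - γ (l + 1) * a)) *
      (1 - a * a) * ∏ k ∈ Finset.Ico (m + 1) L, (1 - γ (k + 1) * a) := by
    rw [prod_Icc_add_one 0, ← Finset.range_eq_Ico, ← Finset.prod_range_succ (n := m)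
      (f := fun l => 1 - γ (l + 1) * a), Finset.prod_range_mul_prod_Ico _ (by omega)]
  rw [hz, zero_sub, g, inv_inv, h1, h2, prod_Icc_add_one (m + 1), Finset.prod_mul_distrib, pow_succ]
  have h3 : a⁻¹ * a = 1 := inv_mul_cancel₀ h0
  linear_combination (a * a⁻¹ ^ m * (∏ j ∈ Finset.range (m + 1), (1 + α j * (a - γ j))) *
    (∏ l ∈ Finset.range m, (1 - γ (l + 1) * a)) *
    ((∏ k ∈ Finset.Ico (m + 1) L, (1 - γ (k + 1) * a⁻¹)) *
      ∏ k ∈ Finset.Ico (m + 1) L, (1 - γ (k + 1) * a))) * h3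

/-- The third product kills the value at `γ i`, and the second the value at its inverse. This is the
source of triangularity. -/
lemma g_sub_at_gamma_eq_zero {K : Type*} [Field K] {L m i : ℕ} (hi : m + 2 ≤ i) (hL : i ≤ L)
    (α γ : ℕ → K) (h0 : γ i ≠ 0) :
    g L α γ m (γ i) - g L α γ m (γ i)⁻¹ = 0 := by
  have h1 : g L α γ m (γ i) = 0 := by
    rw [g, Finset.prod_eq_zero (s := Finset.Icc 1 L) (i := i) (by simp; omega), mul_zero]
    rw [mul_inv_cancel₀ h0, sub_self]
  have h2 : g L α γ m (γ i)⁻¹ = 0 := by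
    rw [g, Finset.prod_eq_zero (s := Finset.Icc (m + 2) L) (i := i) (by simp; omega), mul_zero,
      zero_mul]
    rw [mul_inv_cancel₀ h0, sub_self]
  rw [h1, h2, sub_zero]

/-- The evaluation of `G` at `(γ_L, …, γ_1)`. -/
lemma G_at_gamma {K : Type*} [Field K] (L : ℕ) (α γ : ℕ → K) (h0 : ∀ i, γ i ≠ 0) :
    G L α γ (fun j : Fin L => L - 1 - j) (fun k : Fin L => γ (L - k)) =
      cauchyConst L α γ * weylDenom fun k : Fin L => γ (L - k) := by
  have hsub : ∀ k : Fin L, L - (k : ℕ) = L - 1 - k + 1 := fun k => by omega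
  -- Row `j` carries `m = L - 1 - j` and column `k` carries `γ_{L-k}`: the diagonal is `γ_{m+1}`,
  -- and below it the index is at least `m + 2`.
  rw [G, Matrix.det_of_isUpperTriangular, weylDenom_eq_prod fun k => h0 _]
  · simp only [Matrix.of_apply, hsub]
    rw [prod_fin_pairs_rev L fun m l => γ (m + 1) + (γ (m + 1))⁻¹ - (γ (l + 1) + (γ (l + 1))⁻¹),
      Fin.prod_univ_eq_prod_range (fun i => g L α γ (L - 1 - i) (γ (L - 1 - i + 1)) -
        g L α γ (L - 1 - i) (γ (L - 1 - i + 1))⁻¹),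
      Finset.prod_range_reflect (fun i => g L α γ i (γ (i + 1)) - g L α γ i (γ (i + 1))⁻¹),
      Fin.prod_univ_eq_prod_range (fun i => γ (L - 1 - i + 1) - (γ (L - 1 - i + 1))⁻¹),
      Finset.prod_range_reflect (fun i => γ (i + 1) - (γ (i + 1))⁻¹),
      Finset.prod_congr rfl fun m hm => g_sub_at_gamma (Finset.mem_range.1 hm) α γ (h0 (m + 1)),
      Finset.prod_mul_distrib, prod_range_Ico_comm, cauchyConst_eq_prod_range,
      ← Finset.prod_mul_distrib, ← Finset.prod_mul_distrib, ← Finset.prod_mul_distrib]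
    refine Finset.prod_congr rfl fun m _ => ?_
    have h : ∏ l ∈ Finset.range m,
        (γ (m + 1) + (γ (m + 1))⁻¹ - (γ (l + 1) + (γ (l + 1))⁻¹)) = (γ (m + 1))⁻¹ ^ m *
        ∏ l ∈ Finset.range m, ((1 - γ (m + 1) * (γ (l + 1))⁻¹) * (1 - γ (m + 1) * γ (l + 1))) := by
      have : (γ (m + 1))⁻¹ ^ m = ∏ l ∈ Finset.range m, (γ (m + 1))⁻¹ := by simp
      rw [this, ← Finset.prod_mul_distrib]
      refine Finset.prod_congr rfl fun l _ => ?_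
      rw [add_inv_sub_add_inv (h0 _) (h0 _)]
      ring
    rw [h]
    ring
  · intro j k hkj
    have hkj : (k : ℕ) < j := hkj
    exact g_sub_at_gamma_eq_zero (by omega) (by omega) α γ (h0 _)

/-- The genericity assumptions make the denominator at `γ` nonzero, so the constant can be cancelled
there. -/
lemma G_eq_of_generic {K : Type*} [Field K] {L : ℕ} {α γ : ℕ → K} (h0 : ∀ i, γ i ≠ 0)
    (hne : ∀ i j, i ≠ j → γ i ≠ γ j) (hmul : ∀ i j, γ i * γ j ≠ 1)
    {w : Fin L → K} (hw : ∀ k, w k ≠ 0) :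
    G L α γ (fun j : Fin L => L - 1 - j) w = cauchyConst L α γ * weylDenom w := by
  obtain ⟨d, hd⟩ := exists_G_eq_mul_weylDenom L α γ
  have h := G_at_gamma L α γ h0
  rw [hd _ fun k => h0 _] at h
  rw [hd w hw, mul_right_cancel₀ ?_ h]
  rw [weylDenom_eq_prod fun k => h0 _]
  refine mul_ne_zero (Finset.prod_ne_zero_iff.2 fun k _ h => ?_)
    (Finset.prod_ne_zero_iff.2 fun i _ => Finset.prod_ne_zero_iff.2 fun j hj h => ?_)
  · refine hmul (L - k) (L - k) ?_
    have := mul_inv_cancel₀ (h0 (L - k))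
    rwa [← sub_eq_zero.1 h] at this
  · rw [add_inv_sub_add_inv (h0 _) (h0 _), mul_eq_zero, mul_eq_zero] at h
    have hij : (i : ℕ) < j := Fin.lt_def.1 (Finset.mem_Ioi.1 hj)
    rcases h with (h | h) | h
    · exact inv_ne_zero (h0 _) h
    · refine hne (L - i) (L - j) (by omega) ?_
      rw [sub_eq_zero, eq_comm, mul_inv_eq_one₀ (h0 _)] at h
      exact h
    · exact hmul _ _ (sub_eq_zero.1 h).symm

/-! ### Removing genericity -/

/-- The function `g` with `z` and `z⁻¹` replaced by independent variables. -/
def gTwo {R : Type*} [CommRing R] (L : ℕ) (α γ : ℕ → R) (μ : ℕ) (z z' : R) : R :=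
  (∏ j ∈ Finset.Icc 0 μ, (α j + (1 - α j * γ j) * z)) *
    (∏ j ∈ Finset.Icc (μ + 2) L, (1 - γ j * z)) *
    ∏ j ∈ Finset.Icc 1 L, (1 - γ j * z')

lemma map_gTwo {R S : Type*} [CommRing R] [CommRing S] (φ : R →+* S) (L : ℕ) (α γ : ℕ → R)
    (μ : ℕ) (z z' : R) :
    φ (gTwo L α γ μ z z') = gTwo L (fun i => φ (α i)) (fun i => φ (γ i)) μ (φ z) (φ z') := by
  simp [gTwo]

lemma map_cauchyConst {R S : Type*} [CommRing R] [CommRing S] (φ : R →+* S) (L : ℕ)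
    (α γ : ℕ → R) :
    φ (cauchyConst L α γ) = cauchyConst L (fun i => φ (α i)) (fun i => φ (γ i)) := by
  simp [cauchyConst]

lemma map_det_gTwo {R S : Type*} [CommRing R] [CommRing S] (φ : R →+* S) (L : ℕ) (α γ : ℕ → R)
    {n : ℕ} (μ : Fin n → ℕ) (z z' : Fin n → R) :
    φ (Matrix.of fun j k : Fin n => gTwo L α γ (μ j) (z k) (z' k) -
      gTwo L α γ (μ j) (z' k) (z k)).det =
    (Matrix.of fun j k : Fin n =>
      gTwo L (fun i => φ (α i)) (fun i => φ (γ i)) (μ j) (φ (z k)) (φ (z' k)) -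
      gTwo L (fun i => φ (α i)) (fun i => φ (γ i)) (μ j) (φ (z' k)) (φ (z k))).det := by
  rw [RingHom.map_det]
  congr 1
  ext j k
  simp [map_gTwo]

lemma G_eq_det_gTwo {K : Type*} [Field K] (L : ℕ) (α γ : ℕ → K) {n : ℕ} (μ : Fin n → ℕ)
    (z : Fin n → K) :
    G L α γ μ z = (Matrix.of fun j k : Fin n => gTwo L α γ (μ j) (z k) (z k)⁻¹ -
      gTwo L α γ (μ j) (z k)⁻¹ (z k)).det := by
  simp only [G, g, gTwo, inv_inv]

lemma map_weylDenom {K F : Type*} [Field K] [Field F] (φ : K →+* F) {n : ℕ} (z : Fin n → K) :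
    φ (weylDenom z) = weylDenom fun k => φ (z k) := by
  rw [weylDenom, RingHom.map_det, weylDenom]
  congr 1
  ext j k
  simp

/-- The determinant of all functions `g_0, …, g_{L-1}` in `L` variables. -/
theorem G_staircase_eq {K : Type*} [Field K] {L : ℕ} (α γ : ℕ → K)
    {w : Fin L → K} (hw : ∀ k, w k ≠ 0) :
    G L α γ (fun j : Fin L => L - 1 - j) w = cauchyConst L α γ * weylDenom w := by
  let R := MvPolynomial ℕ K
  let F := FractionRing R
  let ι : R →+* F := algebraMap R F
  have hι : Function.Injective ι := IsFractionRing.injective R F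
  let c : K →+* R := MvPolynomial.C
  let V : ℕ → R := MvPolynomial.X
  -- With indeterminates for `γ`, genericity holds in the fraction field. The inverses of `w` enter
  -- as constants, so the identity already lives in the polynomial ring, where evaluation at any `γ`
  -- is allowed.
  have hR : (Matrix.of fun j k : Fin L =>
      gTwo L (fun i => c (α i)) V (L - 1 - j) (c (w k)) (c (w k)⁻¹) -
      gTwo L (fun i => c (α i)) V (L - 1 - j) (c (w k)⁻¹) (c (w k))).det =
      cauchyConst L (fun i => c (α i)) V * c (weylDenom w) := by
    apply hι
    rw [map_mul, map_det_gTwo, map_cauchyConst]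
    have h := G_eq_of_generic (α := fun i => ι (c (α i))) (γ := fun i => ι (V i))
      (w := fun k => ι (c (w k))) ?_ ?_ ?_ ?_
    · rw [G_eq_det_gTwo] at h
      have e := map_weylDenom (ι.comp c) w
      simp only [RingHom.comp_apply] at e
      rw [e, ← h]
      have e2 : ∀ k, ι (c (w k)⁻¹) = (ι (c (w k)))⁻¹ := fun k => map_inv₀ (ι.comp c) (w k)
      simp only [e2]
    · intro i h
      exact MvPolynomial.X_ne_zero i (hι (h.trans (map_zero ι).symm))
    · intro i j hij h
      exact hij (MvPolynomial.X_injective (hι h))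
    · intro i j h
      rw [← map_mul, ← map_one ι] at h
      have := congrArg (MvPolynomial.eval 0) (hι h)
      simp [V] at this
    · intro k h
      exact hw k ((map_eq_zero (ι.comp c)).1 h)
  have h := congrArg (MvPolynomial.eval γ) hR
  rw [map_mul, map_det_gTwo, map_cauchyConst] at h
  have hc : ∀ a, MvPolynomial.eval γ (c a) = a := fun a => MvPolynomial.eval_C a
  have hV : ∀ i, MvPolynomial.eval γ (V i) = γ i := fun i => MvPolynomial.eval_X i
  simp only [hc, hV] at h
  rw [G_eq_det_gTwo]
  exact h

/-! ### Sign changes and assembly -/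

/-- Each of the `μ + 1` factors involving `α` changes sign; the others depend only on the products
of `γ` with `z` or `z⁻¹`. -/
lemma g_neg {K : Type*} [Field K] (L : ℕ) (α γ : ℕ → K) (μ : ℕ) (z : K) :
    g L (-α) (-γ) μ z = (-1) ^ (μ + 1) * g L α γ μ (-z) := by
  have h : ∏ j ∈ Finset.Icc 0 μ, ((-α) j + (1 - (-α) j * (-γ) j) * z) =
      (-1) ^ (μ + 1) * ∏ j ∈ Finset.Icc 0 μ, (α j + (1 - α j * γ j) * -z) := by
    have : (-1 : K) ^ (μ + 1) = ∏ j ∈ Finset.Icc 0 μ, (-1) := by simp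
    rw [this, ← Finset.prod_mul_distrib]
    refine Finset.prod_congr rfl fun j _ => ?_
    simp only [Pi.neg_apply]
    ring
  rw [g, h]
  simp only [g, Pi.neg_apply, inv_neg, mul_neg, neg_mul, mul_assoc]

lemma G_neg {K : Type*} [Field K] (L : ℕ) (α γ : ℕ → K) {n : ℕ} (μ : Fin n → ℕ) (z : Fin n → K) :
    G L (-α) (-γ) μ z = (∏ b, (-1) ^ (μ b + 1)) * G L α γ μ (-z) := by
  rw [G, G, ← Matrix.det_mul_column]
  congr 1
  ext j k
  simp only [Matrix.of_apply, g_neg, Pi.neg_apply, inv_neg, mul_sub]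

lemma weylDenom_neg {K : Type*} [Field K] {n : ℕ} (z : Fin n → K) :
    weylDenom (-z) = (∏ b : Fin n, (-1) ^ (n - (b : ℕ))) * weylDenom z := by
  rw [weylDenom, weylDenom, ← Matrix.det_mul_column]
  congr 1
  ext j k
  have h : (n : ℤ) - ((j : ℕ) : ℤ) = (n - (j : ℕ) : ℕ) := by omega
  simp only [Matrix.of_apply, Pi.neg_apply, h, zpow_neg, zpow_natCast]
  rw [neg_pow, mul_inv, ← inv_pow (-1 : K), inv_neg_one, mul_sub]

lemma weylDenom_append {K : Type*} [Field K] {N M : ℕ} {x : Fin N → K} {y : Fin M → K}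
    (hx : ∀ j, x j ≠ 0) (hy : ∀ k, y k ≠ 0) :
    weylDenom (Fin.append x y) = weylDenom x * weylDenom y *
      ∏ i, ∏ j, ((x i + (x i)⁻¹) - (y j + (y j)⁻¹)) := by
  have h : ∀ k, Fin.append x y k ≠ 0 := fun k =>
    Fin.addCases (fun i => by simpa using hx i) (fun i => by simpa using hy i) k
  rw [weylDenom_eq_prod h, weylDenom_eq_prod hx, weylDenom_eq_prod hy, prod_pairs_add,
    Fin.prod_univ_add]
  simp only [Fin.append_left, Fin.append_right]
  ring

/-- The Laplace expansion of `G` for the staircase, grouped by partitions. -/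
lemma G_staircase_append {K : Type*} [Field K] {N M : ℕ} (α γ : ℕ → K) (x : Fin N → K)
    (y : Fin M → K) :
    G (N + M) α γ (fun j : Fin (N + M) => N + M - 1 - j) (Fin.append x y) =
      ∑ lam ∈ boxPartitions N M, (∏ b, (-1) ^ hat M lam b) *
        (G (N + M) α γ (fun j => lam j + (N - 1 - (j : ℕ))) x *
          G (N + M) α γ (fun j => hat M lam j + (M - 1 - (j : ℕ))) y) := by
  rw [G, det_eq_sum_shuffles, ← sum_shuffles_eq_sum_boxPartitions]
  refine Finset.sum_congr rfl fun σ hσ => ?_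
  rw [sign_shuffle hσ]
  have h1 : ∀ a : Fin N, N + M - 1 - (σ (Fin.castAdd M a) : ℕ) =
      shufflePartition σ a + (N - 1 - (a : ℕ)) := fun a => by
    have := shuffle_castAdd hσ a
    omega
  have h2 : ∀ b : Fin M, N + M - 1 - (σ (Fin.natAdd N b) : ℕ) =
      hat M (shufflePartition σ) b + (M - 1 - (b : ℕ)) := fun b => by
    have := shuffle_natAdd hσ b
    omega
  simp only [Matrix.of_apply, Fin.append_left, Fin.append_right, h1, h2, G]
  push_cast
  rfl

lemma sum_G_mul_G_neg {K : Type*} [Field K] {N M : ℕ} (α γ : ℕ → K) {x : Fin N → K}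
    {y : Fin M → K} (hx : ∀ j, x j ≠ 0) (hy : ∀ k, y k ≠ 0) :
    ∑ lam ∈ boxPartitions N M, G (N + M) α γ (fun j => lam j + (N - 1 - (j : ℕ))) x *
        G (N + M) (-α) (-γ) (fun j => hat M lam j + (M - 1 - (j : ℕ))) y =
      cauchyConst (N + M) α γ * (weylDenom x * weylDenom y *
        ∏ i, ∏ j, ((x i + (x i)⁻¹) + (y j + (y j)⁻¹))) := by
  have hy' : ∀ k, (-y) k ≠ 0 := fun k => neg_ne_zero.2 (hy k)
  have hw : ∀ k, Fin.append x (-y) k ≠ 0 := fun k =>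
    Fin.addCases (fun i => by simpa using hx i) (fun i => by simpa using hy i) k
  have hs : (∏ b : Fin M, (-1 : K) ^ (M - (b : ℕ))) * ∏ b : Fin M, (-1 : K) ^ (M - (b : ℕ)) = 1 := by
    rw [← Finset.prod_mul_distrib]
    exact Finset.prod_eq_one fun b _ => by rw [← mul_pow]; simp
  have h := G_staircase_eq α γ hw
  rw [G_staircase_append, weylDenom_append hx hy', weylDenom_neg] at h
  simp only [Pi.neg_apply, inv_neg, sub_neg_eq_add, ← neg_add] at h
  calc _ = (∏ b : Fin M, (-1 : K) ^ (M - (b : ℕ))) *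
        ∑ lam ∈ boxPartitions N M, (∏ b, (-1) ^ hat M lam b) *
        (G (N + M) α γ (fun j => lam j + (N - 1 - (j : ℕ))) x *
          G (N + M) α γ (fun j => hat M lam j + (M - 1 - (j : ℕ))) (-y)) := by
        rw [Finset.mul_sum]
        refine Finset.sum_congr rfl fun lam _ => ?_
        -- The sign from `G_neg` splits into the Laplace sign and the sign of `weylDenom_neg`; the
        -- latter cancels against its own copy by `hs`.
        have e : ∏ b : Fin M, (-1 : K) ^ (hat M lam b + (M - 1 - (b : ℕ)) + 1) =
            (∏ b : Fin M, (-1 : K) ^ (M - (b : ℕ))) * ∏ b, (-1) ^ hat M lam b := by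
          rw [← Finset.prod_mul_distrib]
          refine Finset.prod_congr rfl fun b _ => ?_
          rw [← pow_add]
          congr 1
          omega
        rw [G_neg, e]
        ring
    _ = _ := by
        rw [h]
        linear_combination (cauchyConst (N + M) α γ * (weylDenom x * weylDenom y *
          ∏ i, ∏ j, ((x i + (x i)⁻¹) + (y j + (y j)⁻¹)))) * hs

end FactorialSymplectic

/-- The dual Cauchy formula for generalized factorial symplectic Schur functions. -/
theorem mainTheorem7 {K : Type*} [Field K] (N M : ℕ) (x : Fin N → K) (y : Fin M → K)
    (α γ : ℕ → K)
    (hx0 : ∀ j, x j ≠ 0) (hy0 : ∀ k, y k ≠ 0)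
    (hx : FactorialSymplectic.weylDenom x ≠ 0) (hy : FactorialSymplectic.weylDenom y ≠ 0) :
    ∑ lam ∈ FactorialSymplectic.boxPartitions N M,
        FactorialSymplectic.sp (N + M) α γ lam x *
          FactorialSymplectic.sp (N + M) (-α) (-γ) (FactorialSymplectic.hat M lam) y
      = (∏ j : Fin M, y j ^ (-(N : ℤ))) *
        (∏ j : Fin N, ∏ k : Fin M, (1 + x j * y k) * (1 + (x j)⁻¹ * y k)) *
        (∏ k ∈ Finset.range (N + M + 1), ∏ j ∈ Finset.range k, (1 + α j * (γ k - γ j))) *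
        ∏ k ∈ Finset.Icc 1 (N + M), ∏ j ∈ Finset.Ico 1 k, (1 - γ j * γ k) := by
  -- Factorwise, `(x + x⁻¹) + (y + y⁻¹) = y⁻¹ (1 + x y)(1 + x⁻¹ y)`.
  have hprod : ∏ i, ∏ j, ((x i + (x i)⁻¹) + (y j + (y j)⁻¹)) =
      (∏ j : Fin M, y j ^ (-(N : ℤ))) *
        ∏ j : Fin N, ∏ k : Fin M, (1 + x j * y k) * (1 + (x j)⁻¹ * y k) := by
    have e : ∏ j : Fin M, y j ^ (-(N : ℤ)) = ∏ i : Fin N, ∏ j : Fin M, (y j)⁻¹ := by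
      rw [Finset.prod_comm]
      simp
    rw [e, ← Finset.prod_mul_distrib]
    refine Finset.prod_congr rfl fun i _ => ?_
    rw [← Finset.prod_mul_distrib]
    refine Finset.prod_congr rfl fun j _ => ?_
    have := hx0 i
    have := hy0 j
    field_simp
    ring
  rw [← hprod, mul_assoc, ← FactorialSymplectic.cauchyConst.eq_def]
  simp only [FactorialSymplectic.sp, div_mul_div_comm]
  rw [← Finset.sum_div, FactorialSymplectic.sum_G_mul_G_neg α γ hx0 hy0,
    div_eq_iff (mul_ne_zero hx hy)]
  ring
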